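/- Let $\phi_0=1$, $\phi_j(t)=\sqrt2\cos(2\pi jt)$ and $\phi_{-j}(t)=\sqrt2\sin(2\pi jt)$ ($j=1,2,\dots$) be the trigonometric orthonormal basis of $\mathbb L^2=\mathbb L^2([0,1],dx)$, and let $\beta_j=\int_0^1\lambda(t)\phi_j(t)\,dt$ denote the Fourier coefficients of $\lambda\in\mathbb L^2$. Let $\gamma=(\gamma_j)_{j\in\mathbb Z}$ be a strictly positive symmetric sequence with $\gamma_0=1$ such that $(\gamma_k)_{k\ge 0}$ is non-decreasing, let $L>0$, and put $$\Lambda=\Lambda(\gamma,L)=\Big\{\lambda\in\mathbb L^2:\ \lambda\ge 0,\ \sum_{j\in\mathbb Z}\gamma_j^2\beta_j^2\le L^2\Big\}.$$ For $n\in\mathbb N=\{1,2,\dots\}$ let $k_n^*$ be a minimizer over $k\in\mathbb N_0$ of $\max\{\gamma_k^{-2},\frac{2k+1}{n}\}$, and let $\Psi_n=\max\{\gamma_{k_n^*}^{-2},\frac{2k_n^*+1}{n}\}$ be the minimum. Assume that (C1) $\Gamma=\sum_{j\in\mathbb Z}\gamma_j^{-2}<\infty$, and (C2) $0<\eta^{-1}=\inf_{n\in\mathbb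 N}\Psi_n^{-1}\min\{\gamma_{k_n^*}^{-2},\frac{2k_n^*+1}{n}\}$ for some $\eta\ge1$. Then there is a constant $c>0$ depending only on $\eta$, $L$ and $\Gamma$ such that for every $n\in\mathbb N$ $$\inf_{\widetilde\lambda}\ \sup_{\lambda\in\Lambda}\ \mathbb E_\lambda\big[\|\widetilde\lambda-\lambda\|^2\big]\ \ge\ c\,\Psi_n,$$ where $\|\cdot\|$ is the $\mathbb L^2$-norm, the infimum is over all $\mathbb L^2$-valued estimators $\widetilde\lambda$ (measurable functions of the sample $N_1,\dots,N_n$), and under $\mathbb E_\lambda$ the $N_1,\dots,N_n$ are i.i.d. Poisson point processes on $[0,1]$ with intensity function $\lambda$. -/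

import Mathlib

open MeasureTheory Set
open scoped ENNReal unitInterval

noncomputable section

namespace PoissonIntensity

/-- The real Hilbert space `L²([0,1], dx)`. -/
abbrev L2 : Type := Lp ℝ 2 (volume : Measure I)

/-- The trigonometric basis: `φ₀ = 1`, `φ_j(t) = √2 cos(2πjt)` and `φ_{-j}(t) = √2 sin(2πjt)`
for `j = 1, 2, …`. -/
def trigBasis (j : ℤ) (t : I) : ℝ :=
  if j = 0 then 1
  else if 0 < j then √2 * Real.cos (2 * Real.pi * (j : ℝ) * (t : ℝ))
  else √2 * Real.sin (2 * Real.pi * (-(j : ℝ)) * (t : ℝ))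

/-- Fourier coefficient `β_j = ∫₀¹ f(t) φ_j(t) dt`. -/
def fourierCoef (f : L2) (j : ℤ) : ℝ := ∫ t : I, f t * trigBasis j t

/-- Strictly positive symmetric weights with `γ₀ = 1`, non-decreasing on `ℕ₀`. -/
structure IsWeightSeq (γ : ℤ → ℝ) : Prop where
  pos : ∀ j, 0 < γ j
  symm : ∀ j, γ (-j) = γ j
  zero : γ 0 = 1
  mono : Monotone fun k : ℕ => γ (k : ℤ)

/-- The class of non-negative `lam ∈ L²` with `∑_j γ_j² β_j² ≤ L²` (convergence included). -/
def intensityClass (γ : ℤ → ℝ) (L : ℝ) : Set L2 :=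
  {lam | (∀ᵐ t : I, 0 ≤ lam t) ∧
    (Summable fun j : ℤ => γ j ^ 2 * fourierCoef lam j ^ 2) ∧
    ∑' j : ℤ, γ j ^ 2 * fourierCoef lam j ^ 2 ≤ L ^ 2}

/-- The measure `lam(t) dt` on `[0,1]`. -/
def intensityMeasure (lam : L2) : Measure I :=
  volume.withDensity fun t => ENNReal.ofReal (lam t)

/-- Law, on the space of measures on `X` with the σ-algebra generated by the evaluations
`N ↦ N B`, of the Poisson point process with finite intensity measure `μ`: for each `k` there are
`k` points with probability `e^{-μ(X)} μ(X)^k / k!`, and given this the points are i.i.d. with law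
`μ / μ(X)`. The powers of `μ(X)` cancel, so that the `k`-th term is
`e^{-μ(X)} / k!` times the image of `μ^{⊗k}` under `(x₁, …, x_k) ↦ δ_{x₁} + ⋯ + δ_{x_k}`. -/
def poissonProcessLaw {X : Type*} [MeasurableSpace X] (μ : Measure X) : Measure (Measure X) :=
  Measure.sum fun k : ℕ =>
    (ENNReal.ofReal (Real.exp (-μ.real univ)) / (k.factorial : ℝ≥0∞)) •
      (Measure.pi fun _ : Fin k => μ).map fun x => ∑ i, Measure.dirac (x i)

/-- Joint law of `n` i.i.d. Poisson point processes on `[0,1]` with intensity function `lam`. -/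
def sampleLaw (n : ℕ) (lam : L2) : Measure (Fin n → Measure I) :=
  Measure.pi fun _ => poissonProcessLaw (intensityMeasure lam)

/-- Mean integrated squared error `E_lam ‖T(N₁, …, N_n) - lam‖²`, in `[0,∞]`. -/
def mise (n : ℕ) (T : (Fin n → Measure I) → L2) (lam : L2) : ℝ≥0∞ :=
  ∫⁻ N, ENNReal.ofReal (‖T N - lam‖ ^ 2) ∂(sampleLaw n lam)

/-- Minimax risk over the class, the infimum being over all estimators, that is, all measurable
maps from the sample to `L²` (on the separable space `L²` strongly measurable means Borel
measurable). -/
def minimaxRisk (γ : ℤ → ℝ) (L : ℝ) (n : ℕ) : ℝ≥0∞ :=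
  ⨅ (T : (Fin n → Measure I) → L2) (_ : StronglyMeasurable T),
    ⨆ lam ∈ intensityClass γ L, mise n T lam

/-- `max {γ_k⁻², (2k+1)/n}`. -/
def maxTerm (γ : ℤ → ℝ) (n k : ℕ) : ℝ := max (γ k ^ 2)⁻¹ ((2 * (k : ℝ) + 1) / (n : ℝ))

/-- `min {γ_k⁻², (2k+1)/n}`. -/
def minTerm (γ : ℤ → ℝ) (n k : ℕ) : ℝ := min (γ k ^ 2)⁻¹ ((2 * (k : ℝ) + 1) / (n : ℝ))

end PoissonIntensity

end

namespace PoissonIntensity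

/-! Assouad's method on a hypercube of intensities: the constant `L / 2` plus `δ ∑ ± φ_j` over `|j|
≤ k`, where `k` is the optimal index and `δ² = ζ / n`. Three constraints fix `ζ`. The cube lies in
the ellipsoid because (C2) gives `(2k+1) / n * γ_k² ≤ η`. The intensities stay above `L / 4` because
Cauchy–Schwarz and (C1) give `(2k+1)² ≤ Γ ∑ γ_j²`. Flipping one sign keeps the sample laws close
because `n δ²` is small relative to `L`. Each of the `2k+1` coordinates then costs a constant times
`δ²`, and by (C2) the total is of order `Ψ_n`.

Closeness is measured by `ChiSqDominated`: the inequality `(∫ f dP')² ≤ C ∫ f² dP` avoids densities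
on the space of point configurations and passes through images, sums and products. For Poisson
processes with intensities `g`, `f` it gives the constant `exp (∫ (g - f)² / f)`, bounded in
`chiSqDominated_sampleLaw`. The remaining steps are `ofReal_sq_sub_le_of_chiSqDominated` (two
points), `card_mul_le_two_mul_sum_of_flip` (averaging) and Bessel's inequality. -/

/-! ### Chi-square domination and its stability -/

/-- `P'` is dominated by `P` in the `χ²` sense with constant `C`. -/
def ChiSqDominated {α : Type*} [MeasurableSpace α] (P' P : Measure α) (C : ℝ≥0∞) : Prop :=
  ∀ f : α → ℝ≥0∞, Measurable f → (∫⁻ x, f x ∂P') ^ 2 ≤ C * ∫⁻ x, f x ^ 2 ∂P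

theorem lintegral_mul_sq_le {α : Type*} [MeasurableSpace α] (μ : Measure α)
    {f g : α → ℝ≥0∞} (hf : AEMeasurable f μ) (hg : AEMeasurable g μ) :
    (∫⁻ x, f x * g x ∂μ) ^ 2 ≤ (∫⁻ x, f x ^ 2 ∂μ) * ∫⁻ x, g x ^ 2 ∂μ := by
  have h := ENNReal.lintegral_mul_le_Lp_mul_Lq μ Real.HolderConjugate.two_two hf hg
  simp only [ENNReal.rpow_two, Pi.mul_apply] at h
  calc (∫⁻ x, f x * g x ∂μ) ^ 2
      ≤ ((∫⁻ x, f x ^ 2 ∂μ) ^ (1 / 2 : ℝ) * (∫⁻ x, g x ^ 2 ∂μ) ^ (1 / 2 : ℝ)) ^ 2 := by gcongr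
    _ = _ := by
      rw [mul_pow, ← ENNReal.rpow_natCast, ← ENNReal.rpow_natCast, ← ENNReal.rpow_mul,
        ← ENNReal.rpow_mul]
      norm_num

theorem sq_tsum_le_of_sq_le {a b c : ℕ → ℝ≥0∞} (h : ∀ k, a k ^ 2 ≤ c k * b k) :
    (∑' k, a k) ^ 2 ≤ (∑' k, c k) * ∑' k, b k := by
  have hs : ∀ x : ℝ≥0∞, (x ^ (1 / 2 : ℝ)) ^ 2 = x := fun x => by
    rw [← ENNReal.rpow_natCast, ← ENNReal.rpow_mul]; norm_num
  have hk : ∀ k, a k ≤ c k ^ (1 / 2 : ℝ) * b k ^ (1 / 2 : ℝ) := fun k => by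
    refine (ENNReal.pow_le_pow_left_iff two_ne_zero).1 ?_
    rw [mul_pow, hs, hs]; exact h k
  have := lintegral_mul_sq_le (Measure.count : Measure ℕ)
    (f := fun k => c k ^ (1 / 2 : ℝ)) (g := fun k => b k ^ (1 / 2 : ℝ))
    (measurable_of_countable _).aemeasurable (measurable_of_countable _).aemeasurable
  simp only [lintegral_count, hs] at this
  refine le_trans ?_ this
  gcongr with k
  exact hk k

namespace ChiSqDominated

variable {α β : Type*} [MeasurableSpace α] [MeasurableSpace β] {P' P : Measure α} {C : ℝ≥0∞}

theorem mono (h : ChiSqDominated P' P C) {C' : ℝ≥0∞} (hC : C ≤ C') :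
    ChiSqDominated P' P C' := fun f hf => (h f hf).trans (by gcongr)

theorem map (h : ChiSqDominated P' P C) {φ : α → β} (hφ : Measurable φ) :
    ChiSqDominated (P'.map φ) (P.map φ) C := fun f hf => by
  rw [lintegral_map hf hφ, lintegral_map (hf.pow_const 2) hφ]
  exact h _ (hf.comp hφ)

theorem smul (h : ChiSqDominated P' P C) {a b c : ℝ≥0∞} (hc : a ^ 2 = c * b) :
    ChiSqDominated (a • P') (b • P) (c * C) := fun f hf => by
  rw [lintegral_smul_measure, lintegral_smul_measure, smul_eq_mul, smul_eq_mul, mul_pow, hc]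
  calc c * b * (∫⁻ x, f x ∂P') ^ 2 ≤ c * b * (C * ∫⁻ x, f x ^ 2 ∂P) := by gcongr; exact h f hf
    _ = _ := by ring

theorem sum {P' P : ℕ → Measure α} {C : ℕ → ℝ≥0∞} (h : ∀ k, ChiSqDominated (P' k) (P k) (C k)) :
    ChiSqDominated (Measure.sum P') (Measure.sum P) (∑' k, C k) := fun f hf => by
  rw [lintegral_sum_measure, lintegral_sum_measure]
  exact sq_tsum_le_of_sq_le fun k => h k f hf

theorem prod {Q' Q : Measure β} [SFinite Q'] [SFinite Q] [SFinite P'] [SFinite P]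
    {D : ℝ≥0∞} (h : ChiSqDominated P' P C)
    (hQ : ChiSqDominated Q' Q D) : ChiSqDominated (P'.prod Q') (P.prod Q) (C * D) := fun f hf => by
  rw [lintegral_prod _ hf.aemeasurable, lintegral_prod _ (hf.pow_const 2).aemeasurable]
  calc _ ≤ C * ∫⁻ x, (∫⁻ y, f (x, y) ∂Q') ^ 2 ∂P := h _ hf.lintegral_prod_right'
    _ ≤ C * ∫⁻ x, D * ∫⁻ y, f (x, y) ^ 2 ∂Q ∂P := by
      gcongr with x
      exact hQ _ (hf.comp measurable_prodMk_left)
    _ = _ := by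
      rw [lintegral_const_mul, mul_assoc]
      exact (hf.pow_const 2).lintegral_prod_right'

theorem pi [SigmaFinite P'] [SigmaFinite P] (h : ChiSqDominated P' P C) (n : ℕ) :
    ChiSqDominated (Measure.pi fun _ : Fin n => P') (Measure.pi fun _ : Fin n => P) (C ^ n) := by
  induction n with
  | zero =>
    intro f hf
    rw [Measure.pi_of_empty _ isEmptyElim, Measure.pi_of_empty _ isEmptyElim]
    simp [lintegral_dirac]
  | succ n ih =>
    have e' := (measurePreserving_piFinSuccAbove (fun _ : Fin (n + 1) => P') 0).symm
    have e := (measurePreserving_piFinSuccAbove (fun _ : Fin (n + 1) => P) 0).symm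
    rw [← e'.map_eq, ← e.map_eq, pow_succ']
    exact (h.prod ih).map e.measurable

/-- Cauchy–Schwarz under `p ν`, after writing `p' = p * (p' / p)`. -/
theorem withDensity (ν : Measure α) {p' p : α → ℝ≥0∞} (hp' : Measurable p') (hp : Measurable p)
    (h0 : ∀ x, p x ≠ 0) (h1 : ∀ x, p x ≠ ∞) :
    ChiSqDominated (ν.withDensity p') (ν.withDensity p) (∫⁻ x, p' x ^ 2 / p x ∂ν) :=
  fun f hf => by
  have hq : Measurable fun x => p' x / p x := hp'.div hp
  have hcan : ∀ x, p x * (p' x / p x) = p' x := fun x => ENNReal.mul_div_cancel (h0 x) (h1 x)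
  have e : ∫⁻ x, f x ∂(ν.withDensity p') = ∫⁻ x, (p' x / p x) * f x ∂(ν.withDensity p) := by
    rw [lintegral_withDensity_eq_lintegral_mul _ hp' hf,
      lintegral_withDensity_eq_lintegral_mul _ hp
        (show Measurable fun x => p' x / p x * f x from hq.mul hf)]
    refine lintegral_congr fun x => ?_
    simp only [Pi.mul_apply]
    rw [← mul_assoc, hcan]
  have e2 : ∫⁻ x, p' x ^ 2 / p x ∂ν = ∫⁻ x, (p' x / p x) ^ 2 ∂(ν.withDensity p) := by
    rw [lintegral_withDensity_eq_lintegral_mul _ hp (hq.pow_const 2)]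
    refine lintegral_congr fun x => ?_
    simp only [Pi.mul_apply]
    rw [sq (p' x / p x), ← mul_assoc, hcan, sq, mul_div_assoc]
  rw [e, e2]
  exact lintegral_mul_sq_le _ hq.aemeasurable hf.aemeasurable

end ChiSqDominated

/-! ### Laws of Poisson point processes -/

theorem measurable_sum_dirac {X : Type*} [MeasurableSpace X] (k : ℕ) :
    Measurable fun x : Fin k → X => ∑ i, Measure.dirac (x i) := by
  refine Measure.measurable_of_measurable_coe _ fun s hs => ?_
  simp only [Measure.coe_finsetSum, Finset.sum_apply]
  refine Finset.measurable_sum _ fun i _ => ?_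
  exact (Measure.measurable_coe hs).comp (Measure.measurable_dirac.comp (measurable_pi_apply i))

/-- The exponent `a` is free: `a = -m` gives total mass one, and another `a` gives the chi-square
constant. -/
theorem tsum_exp_weight {a m : ℝ} (hm : 0 ≤ m) :
    ∑' k : ℕ, ENNReal.ofReal (Real.exp a) / (k.factorial : ℝ≥0∞) * ENNReal.ofReal m ^ k
      = ENNReal.ofReal (Real.exp (a + m)) := by
  have h : ∀ k : ℕ, ENNReal.ofReal (Real.exp a) / (k.factorial : ℝ≥0∞) * ENNReal.ofReal m ^ k
      = ENNReal.ofReal (Real.exp a * (m ^ k / k.factorial)) := fun k => by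
    rw [← ENNReal.ofReal_pow hm, ← ENNReal.ofReal_natCast, ← ENNReal.ofReal_div_of_pos
      (by positivity), ← ENNReal.ofReal_mul (by positivity)]
    congr 1; ring
  have hs := (NormedSpace.expSeries_div_hasSum_exp m).mul_left (Real.exp a)
  simp_rw [h]
  rw [← ENNReal.ofReal_tsum_of_nonneg (fun k => by positivity) hs.summable, hs.tsum_eq,
    Real.exp_add, Real.exp_eq_exp_ℝ]

section Poisson

variable {X : Type*} [MeasurableSpace X] {μ' μ : Measure X}

instance isProbabilityMeasure_poissonProcessLaw [IsFiniteMeasure μ] :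
    IsProbabilityMeasure (poissonProcessLaw μ) := by
  constructor
  rw [poissonProcessLaw, Measure.sum_apply _ MeasurableSet.univ]
  have h : ∀ k : ℕ, ((Measure.pi fun _ : Fin k => μ).map
      fun x => ∑ i, Measure.dirac (x i)) univ = ENNReal.ofReal (μ.real univ) ^ k := fun k => by
    rw [Measure.map_apply (measurable_sum_dirac k) MeasurableSet.univ, preimage_univ,
      Measure.pi_univ]
    simp [ofReal_measureReal]
  simp only [Measure.smul_apply, h, smul_eq_mul]
  rw [tsum_exp_weight measureReal_nonneg]
  simp

/-- The `k`-point parts are dominated with constant `C ^ k`. The weights contribute `(e^{-μ'(X)} /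
k!)² / (e^{-μ(X)} / k!) = e^{μ(X) - 2μ'(X)} / k!`, and the sum over `k` is an exponential series. -/
theorem ChiSqDominated.poissonProcessLaw [IsFiniteMeasure μ'] [IsFiniteMeasure μ] {C : ℝ}
    (hC : 0 ≤ C) (h : ChiSqDominated μ' μ (ENNReal.ofReal C)) :
    ChiSqDominated (poissonProcessLaw μ') (poissonProcessLaw μ)
      (ENNReal.ofReal (Real.exp (μ.real univ - 2 * μ'.real univ + C))) := by
  rw [← tsum_exp_weight hC]
  refine ChiSqDominated.sum fun k => ChiSqDominated.smul ((h.pi k).map (measurable_sum_dirac k)) ?_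
  rw [div_eq_mul_inv, div_eq_mul_inv, div_eq_mul_inv, mul_pow, mul_mul_mul_comm, ← sq,
    ← ENNReal.ofReal_pow (by positivity), ← ENNReal.ofReal_mul (by positivity), ← Real.exp_add,
    ← Real.exp_nat_mul]
  congr 4
  push_cast; ring

end Poisson

/-! ### Orthonormality of the trigonometric basis -/

theorem continuous_trigBasis (j : ℤ) : Continuous (trigBasis j) := by
  unfold trigBasis
  split_ifs <;> fun_prop

theorem abs_trigBasis_le (j : ℤ) (t : I) : |trigBasis j t| ≤ √2 := by
  have h1 : (1 : ℝ) ≤ √2 := Real.one_le_sqrt.2 one_le_two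
  unfold trigBasis
  split_ifs
  · simp [h1]
  · rw [abs_mul, abs_of_nonneg (Real.sqrt_nonneg 2)]
    exact mul_le_of_le_one_right (Real.sqrt_nonneg 2) (Real.abs_cos_le_one _)
  · rw [abs_mul, abs_of_nonneg (Real.sqrt_nonneg 2)]
    exact mul_le_of_le_one_right (Real.sqrt_nonneg 2) (Real.abs_sin_le_one _)

theorem integral_unitInterval_eq (f : ℝ → ℝ) : ∫ t : I, f t = ∫ t in (0 : ℝ)..1, f t := by
  rw [intervalIntegral.integral_of_le zero_le_one, ← integral_Icc_eq_integral_Ioc,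
    ← integral_subtype measurableSet_Icc]

theorem integral_cos_two_pi_int (m : ℤ) :
    ∫ t : I, Real.cos (2 * Real.pi * m * t) = if m = 0 then 1 else 0 := by
  rw [integral_unitInterval_eq fun t => Real.cos (2 * Real.pi * m * t)]
  split_ifs with h
  · simp [h]
  · have hm : (2 * Real.pi * m : ℝ) ≠ 0 := by
      have : (m : ℝ) ≠ 0 := by exact_mod_cast h
      positivity
    rw [intervalIntegral.integral_comp_mul_left (fun t => Real.cos t) hm, integral_cos]
    have : Real.sin (2 * Real.pi * m) = 0 := by
      rw [show 2 * Real.pi * m = ((2 * m : ℤ) : ℝ) * Real.pi by push_cast; ring]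
      exact Real.sin_int_mul_pi _
    simp [this]

theorem integral_sin_two_pi_int (m : ℤ) :
    ∫ t : I, Real.sin (2 * Real.pi * m * t) = 0 := by
  rw [integral_unitInterval_eq fun t => Real.sin (2 * Real.pi * m * t)]
  by_cases h : m = 0
  · simp [h]
  · have hm : (2 * Real.pi * m : ℝ) ≠ 0 := by
      have : (m : ℝ) ≠ 0 := by exact_mod_cast h
      positivity
    rw [intervalIntegral.integral_comp_mul_left (fun t => Real.sin t) hm, integral_sin]
    have : Real.cos (2 * Real.pi * m) = 1 := by
      rw [show 2 * Real.pi * m = (m : ℝ) * (2 * Real.pi) by ring]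
      exact Real.cos_int_mul_two_pi _
    simp [this]

theorem integrable_of_continuous {f : I → ℝ} (hf : Continuous f) : Integrable f :=
  hf.integrable_of_hasCompactSupport (HasCompactSupport.of_compactSpace f)

theorem integral_cos_mul_cos (i j : ℤ) :
    ∫ t : I, Real.cos (2 * Real.pi * i * t) * Real.cos (2 * Real.pi * j * t)
      = ((if i = j then 1 else 0) + if i = -j then 1 else 0) / 2 := by
  have h : ∀ t : I, Real.cos (2 * Real.pi * i * t) * Real.cos (2 * Real.pi * j * t)
      = (Real.cos (2 * Real.pi * (i - j : ℤ) * t) + Real.cos (2 * Real.pi * (i + j : ℤ) * t)) / 2 :=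
    fun t => by
      rw [show 2 * Real.pi * ((i - j : ℤ) : ℝ) * t = 2 * Real.pi * i * t - 2 * Real.pi * j * t by
          push_cast; ring,
        show 2 * Real.pi * ((i + j : ℤ) : ℝ) * t = 2 * Real.pi * i * t + 2 * Real.pi * j * t by
          push_cast; ring, Real.cos_sub, Real.cos_add]
      ring
  simp_rw [h]
  rw [integral_div, integral_add (integrable_of_continuous (by fun_prop))
    (integrable_of_continuous (by fun_prop)), integral_cos_two_pi_int, integral_cos_two_pi_int]
  simp only [sub_eq_zero, add_eq_zero_iff_eq_neg]

theorem integral_sin_mul_sin (i j : ℤ) :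
    ∫ t : I, Real.sin (2 * Real.pi * i * t) * Real.sin (2 * Real.pi * j * t)
      = ((if i = j then 1 else 0) - if i = -j then 1 else 0) / 2 := by
  have h : ∀ t : I, Real.sin (2 * Real.pi * i * t) * Real.sin (2 * Real.pi * j * t)
      = (Real.cos (2 * Real.pi * (i - j : ℤ) * t) - Real.cos (2 * Real.pi * (i + j : ℤ) * t)) / 2 :=
    fun t => by
      rw [show 2 * Real.pi * ((i - j : ℤ) : ℝ) * t = 2 * Real.pi * i * t - 2 * Real.pi * j * t by
          push_cast; ring,
        show 2 * Real.pi * ((i + j : ℤ) : ℝ) * t = 2 * Real.pi * i * t + 2 * Real.pi * j * t by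
          push_cast; ring, Real.cos_sub, Real.cos_add]
      ring
  simp_rw [h]
  rw [integral_div, integral_sub (integrable_of_continuous (by fun_prop))
    (integrable_of_continuous (by fun_prop)), integral_cos_two_pi_int, integral_cos_two_pi_int]
  simp only [sub_eq_zero, add_eq_zero_iff_eq_neg]

theorem integral_sin_mul_cos (i j : ℤ) :
    ∫ t : I, Real.sin (2 * Real.pi * i * t) * Real.cos (2 * Real.pi * j * t) = 0 := by
  have h : ∀ t : I, Real.sin (2 * Real.pi * i * t) * Real.cos (2 * Real.pi * j * t)
      = (Real.sin (2 * Real.pi * (i - j : ℤ) * t) + Real.sin (2 * Real.pi * (i + j : ℤ) * t)) / 2 :=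
    fun t => by
      rw [show 2 * Real.pi * ((i - j : ℤ) : ℝ) * t = 2 * Real.pi * i * t - 2 * Real.pi * j * t by
          push_cast; ring,
        show 2 * Real.pi * ((i + j : ℤ) : ℝ) * t = 2 * Real.pi * i * t + 2 * Real.pi * j * t by
          push_cast; ring, Real.sin_sub, Real.sin_add]
      ring
  simp_rw [h]
  rw [integral_div, integral_add (integrable_of_continuous (by fun_prop))
    (integrable_of_continuous (by fun_prop)), integral_sin_two_pi_int, integral_sin_two_pi_int]
  simp

theorem trigBasis_of_nonneg {j : ℤ} (hj : 0 ≤ j) (t : I) :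
    trigBasis j t = (if j = 0 then 1 else √2) * Real.cos (2 * Real.pi * j * t) := by
  unfold trigBasis
  split_ifs with h h'
  · simp [h]
  · rfl
  · omega

theorem trigBasis_of_neg {j : ℤ} (hj : j < 0) (t : I) :
    trigBasis j t = -√2 * Real.sin (2 * Real.pi * j * t) := by
  unfold trigBasis
  rw [if_neg hj.ne, if_neg hj.not_gt, mul_neg, neg_mul, Real.sin_neg]
  ring

theorem integral_trigBasis_mul (i j : ℤ) :
    ∫ t : I, trigBasis i t * trigBasis j t = if i = j then 1 else 0 := by
  have h2 : √2 * √2 = (2 : ℝ) := Real.mul_self_sqrt zero_le_two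
  rcases le_or_gt 0 i with hi | hi <;> rcases le_or_gt 0 j with hj | hj
  · simp_rw [trigBasis_of_nonneg hi, trigBasis_of_nonneg hj, mul_mul_mul_comm _ (Real.cos _)]
    rw [integral_const_mul, integral_cos_mul_cos]
    by_cases h : i = j
    · subst h
      by_cases h0 : i = 0
      · simp [h0]
      · have : i ≠ -i := by omega
        simp [h0, this, h2]
    · have : i ≠ -j := by omega
      simp [h, this]
  · simp_rw [trigBasis_of_nonneg hi, trigBasis_of_neg hj, mul_mul_mul_comm _ (Real.cos _),
      mul_comm (Real.cos _)]
    rw [integral_const_mul, integral_sin_mul_cos, mul_zero, if_neg (show i ≠ j by omega)]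
  · simp_rw [trigBasis_of_neg hi, trigBasis_of_nonneg hj, mul_mul_mul_comm _ (Real.sin _)]
    rw [integral_const_mul, integral_sin_mul_cos, mul_zero, if_neg (show i ≠ j by omega)]
  · simp_rw [trigBasis_of_neg hi, trigBasis_of_neg hj, mul_mul_mul_comm _ (Real.sin _)]
    rw [integral_const_mul, integral_sin_mul_sin, if_neg (show i ≠ -j by omega), neg_mul_neg, h2]
    split_ifs <;> norm_num

/-- The element of `L²([0,1])` given by a continuous function. -/
noncomputable def contL2 (f : C(I, ℝ)) : L2 := ContinuousMap.toLp 2 volume ℝ f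

theorem coeFn_contL2 (f : C(I, ℝ)) : contL2 f =ᵐ[volume] f := ContinuousMap.coeFn_toLp _ f

theorem fourierCoef_contL2 (f : C(I, ℝ)) (j : ℤ) :
    fourierCoef (contL2 f) j = ∫ t : I, f t * trigBasis j t := by
  refine integral_congr_ae ?_
  filter_upwards [coeFn_contL2 f] with t ht
  rw [ht]

theorem inner_contL2_trigBasis (f : L2) (j : ℤ) :
    inner ℝ (contL2 ⟨trigBasis j, continuous_trigBasis j⟩) f = fourierCoef f j := by
  rw [L2.inner_def]
  refine integral_congr_ae ?_
  filter_upwards [coeFn_contL2 ⟨trigBasis j, continuous_trigBasis j⟩] with t ht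
  rw [ht]
  simp

theorem orthonormal_trigBasis :
    Orthonormal ℝ fun j : ℤ => contL2 ⟨trigBasis j, continuous_trigBasis j⟩ := by
  rw [orthonormal_iff_ite]
  intro i j
  rw [inner_contL2_trigBasis, fourierCoef_contL2]
  simp only [ContinuousMap.coe_mk]
  rw [integral_trigBasis_mul]
  simp only [eq_comm]

theorem continuous_fourierCoef (j : ℤ) : Continuous fun f : L2 => fourierCoef f j := by
  simp_rw [← inner_contL2_trigBasis]
  fun_prop

/-- Bessel's inequality; it reduces the `L²` loss to separate coordinates. -/
theorem sum_fourierCoef_sub_sq_le (f g : L2) (s : Finset ℤ) :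
    ∑ j ∈ s, (fourierCoef f j - fourierCoef g j) ^ 2 ≤ ‖f - g‖ ^ 2 := by
  have h := orthonormal_trigBasis.sum_inner_products_le (f - g) (s := s)
  simpa only [inner_sub_right, inner_contL2_trigBasis, Real.norm_eq_abs, sq_abs] using h

/-! ### Comparison of sample laws with continuous intensities -/

theorem intensityMeasure_contL2 (f : C(I, ℝ)) :
    intensityMeasure (contL2 f) = volume.withDensity fun t => ENNReal.ofReal (f t) := by
  refine withDensity_congr_ae ?_
  filter_upwards [coeFn_contL2 f] with t ht
  rw [ht]

instance isFiniteMeasure_intensityMeasure (lam : L2) : IsFiniteMeasure (intensityMeasure lam) :=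
  isFiniteMeasure_withDensity_ofReal ((Lp.memLp lam).integrable one_le_two).hasFiniteIntegral

instance isProbabilityMeasure_sampleLaw (n : ℕ) (lam : L2) :
    IsProbabilityMeasure (sampleLaw n lam) := by
  unfold sampleLaw; infer_instance

theorem intensityMeasure_contL2_real_univ {f : C(I, ℝ)} (hf : ∀ t, 0 ≤ f t) :
    (intensityMeasure (contL2 f)).real univ = ∫ t, f t := by
  rw [intensityMeasure_contL2, Measure.real, withDensity_apply _ MeasurableSet.univ,
    Measure.restrict_univ, ← ofReal_integral_eq_lintegral_ofReal
      (integrable_of_continuous f.continuous) (Filter.Eventually.of_forall hf),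
    ENNReal.toReal_ofReal (integral_nonneg hf)]

/-- Chi-square domination of samples with intensities that are uniformly close. -/
theorem chiSqDominated_sampleLaw (n : ℕ) {f g : C(I, ℝ)} {b ε : ℝ} (hb : 0 < b)
    (hf : ∀ t, b ≤ f t) (hg : ∀ t, 0 ≤ g t) (hfg : ∀ t, (g t - f t) ^ 2 ≤ ε) :
    ChiSqDominated (sampleLaw n (contL2 g)) (sampleLaw n (contL2 f))
      (ENNReal.ofReal (Real.exp (n * (ε / b)))) := by
  have hf0 : ∀ t, 0 < f t := fun t => hb.trans_le (hf t)
  -- The linear part `2g - f` integrates to exactly what the total masses cancel in the Poisson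
  -- exponent, leaving `ε / b`.
  have hpt : ∀ t, g t ^ 2 / f t ≤ 2 * g t - f t + ε / b := fun t => by
    have h1 : g t ^ 2 / f t = 2 * g t - f t + (g t - f t) ^ 2 / f t := by
      field_simp [(hf0 t).ne']; ring
    have h2 : (g t - f t) ^ 2 / f t ≤ ε / b :=
      div_le_div₀ ((sq_nonneg _).trans (hfg t)) (hfg t) hb (hf t)
    linarith
  have hpt0 : ∀ t, 0 ≤ 2 * g t - f t + ε / b := fun t =>
    (div_nonneg (sq_nonneg _) (hf0 t).le).trans (hpt t)
  have hgi := integrable_of_continuous g.continuous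
  have hfi := integrable_of_continuous f.continuous
  have hint : ∫ t, (2 * g t - f t + ε / b) = 2 * (∫ t, g t) - (∫ t, f t) + ε / b := by
    rw [integral_add (f := fun t => 2 * g t - f t) ((hgi.const_mul 2).sub hfi)
      (integrable_const _), integral_sub (hgi.const_mul 2) hfi, integral_const_mul]
    simp
  have key : ChiSqDominated (intensityMeasure (contL2 g)) (intensityMeasure (contL2 f))
      (ENNReal.ofReal (2 * (∫ t, g t) - (∫ t, f t) + ε / b)) := by
    rw [intensityMeasure_contL2, intensityMeasure_contL2]
    refine (ChiSqDominated.withDensity volume (by fun_prop) (by fun_prop)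
      (fun t => (ENNReal.ofReal_pos.2 (hf0 t)).ne') fun t => ENNReal.ofReal_ne_top).mono ?_
    rw [← hint, ofReal_integral_eq_lintegral_ofReal (integrable_of_continuous (by fun_prop))
      (Filter.Eventually.of_forall hpt0)]
    refine lintegral_mono fun t => ?_
    simp only
    rw [← ENNReal.ofReal_pow (hg t), ← ENNReal.ofReal_div_of_pos (hf0 t)]
    exact ENNReal.ofReal_le_ofReal (hpt t)
  have h := (key.poissonProcessLaw (by rw [← hint]; exact integral_nonneg hpt0)).pi n
  rw [intensityMeasure_contL2_real_univ hg, intensityMeasure_contL2_real_univ fun t => (hf0 t).le]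
    at h
  refine h.mono (le_of_eq ?_)
  rw [← ENNReal.ofReal_pow (by positivity), ← Real.exp_nat_mul]
  congr 3
  ring

/-! ### Two-point bound and hypercube averaging -/

/-- Two-point lower bound for estimating a real parameter in squared error. -/
theorem ofReal_sq_sub_le_of_chiSqDominated {Ω : Type*} [MeasurableSpace Ω] {P' P : Measure Ω}
    [IsProbabilityMeasure P'] {K : ℝ≥0∞} (hK : 1 ≤ K) (h : ChiSqDominated P' P K)
    {T : Ω → ℝ} (hT : Measurable T) (x x' : ℝ) :
    ENNReal.ofReal ((x - x') ^ 2) ≤ 2 * K * (∫⁻ ω, ENNReal.ofReal ((T ω - x) ^ 2) ∂P +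
      ∫⁻ ω, ENNReal.ofReal ((T ω - x') ^ 2) ∂P') := by
  have hm : ∀ y : ℝ, Measurable fun ω => ENNReal.ofReal |T ω - y| := fun y => by fun_prop
  have hsq : ∀ y : ℝ, ENNReal.ofReal |y| ^ 2 = ENNReal.ofReal (y ^ 2) := fun y => by
    rw [← ENNReal.ofReal_pow (abs_nonneg _), sq_abs]
  have h1 := h _ (hm x)
  have h2 := lintegral_mul_sq_le P' (hm x').aemeasurable (g := fun _ => 1) aemeasurable_const
  simp only [hsq] at h1 h2
  simp only [mul_one, one_pow, lintegral_const, measure_univ] at h2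
  -- Both errors are taken under `P'`; domination then moves only the error at `x` to `P`.
  have h3 : ENNReal.ofReal |x - x'| ≤
      ∫⁻ ω, ENNReal.ofReal |T ω - x| ∂P' + ∫⁻ ω, ENNReal.ofReal |T ω - x'| ∂P' := by
    rw [← lintegral_add_left (hm x)]
    calc ENNReal.ofReal |x - x'| = ∫⁻ _, ENNReal.ofReal |x - x'| ∂P' := by simp
      _ ≤ _ := lintegral_mono fun ω => by
        rw [← ENNReal.ofReal_add (abs_nonneg _) (abs_nonneg _)]
        refine ENNReal.ofReal_le_ofReal ?_
        rw [abs_sub_comm (T ω) x]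
        exact abs_sub_le _ _ _
  calc ENNReal.ofReal ((x - x') ^ 2) = ENNReal.ofReal |x - x'| ^ 2 := (hsq _).symm
    _ ≤ (∫⁻ ω, ENNReal.ofReal |T ω - x| ∂P' + ∫⁻ ω, ENNReal.ofReal |T ω - x'| ∂P') ^ 2 := by
      gcongr
    _ ≤ 2 * ((∫⁻ ω, ENNReal.ofReal |T ω - x| ∂P') ^ 2
          + (∫⁻ ω, ENNReal.ofReal |T ω - x'| ∂P') ^ 2) := by
      have h4 := ENNReal.rpow_add_le_mul_rpow_add_rpow (∫⁻ ω, ENNReal.ofReal |T ω - x| ∂P')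
        (∫⁻ ω, ENNReal.ofReal |T ω - x'| ∂P') one_le_two
      simp only [ENNReal.rpow_two] at h4
      norm_num at h4
      exact h4
    _ ≤ 2 * (K * ∫⁻ ω, ENNReal.ofReal ((T ω - x) ^ 2) ∂P
          + K * ∫⁻ ω, ENNReal.ofReal ((T ω - x') ^ 2) ∂P') := by
      gcongr
      exact h2.trans (le_mul_of_one_le_left zero_le hK)
    _ = _ := by ring

/-- Averaging over the hypercube in Assouad's lemma. -/
theorem card_mul_le_two_mul_sum_of_flip {ι : Type*} [Fintype ι] [DecidableEq ι]
    (A : ι → (ι → Bool) → ℝ≥0∞) (x : ℝ≥0∞)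
    (h : ∀ i θ, x ≤ A i θ + A i (Function.update θ i (!θ i))) :
    (Fintype.card (ι → Bool) : ℝ≥0∞) * (Fintype.card ι * x) ≤ 2 * ∑ θ, ∑ i, A i θ := by
  have hi : ∀ i, (Fintype.card (ι → Bool) : ℝ≥0∞) * x ≤ 2 * ∑ θ, A i θ := fun i => by
    have hinv : Function.Involutive fun θ : ι → Bool => Function.update θ i (!θ i) := fun θ => by
      simp
    have hs : ∑ θ, A i (Function.update θ i (!θ i)) = ∑ θ, A i θ :=
      Equiv.sum_comp hinv.toPerm (A i)
    calc (Fintype.card (ι → Bool) : ℝ≥0∞) * x = ∑ _θ : ι → Bool, x := by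
          rw [Finset.sum_const, nsmul_eq_mul, Finset.card_univ]
      _ ≤ ∑ θ, (A i θ + A i (Function.update θ i (!θ i))) := Finset.sum_le_sum fun θ _ => h i θ
      _ = _ := by rw [Finset.sum_add_distrib, hs, two_mul]
  rw [Finset.sum_comm, Finset.mul_sum]
  calc _ = ∑ _i : ι, (Fintype.card (ι → Bool) : ℝ≥0∞) * x := by
        rw [Finset.sum_const, nsmul_eq_mul, Finset.card_univ]; ring
    _ ≤ _ := Finset.sum_le_sum fun i _ => hi i

/-! ### The hypercube of intensities -/

/-- The sign `1` or `-1`. -/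
def signOf (b : Bool) : ℝ := if b then 1 else -1

theorem signOf_sq (b : Bool) : signOf b ^ 2 = 1 := by cases b <;> simp [signOf]

theorem abs_signOf (b : Bool) : |signOf b| = 1 := by cases b <;> simp [signOf]

theorem signOf_sub_not_sq (b : Bool) : (signOf b - signOf (!b)) ^ 2 = 4 := by
  cases b <;> norm_num [signOf]

/-- The hypercube intensity `a + δ ∑_{i ∈ s} ± φ_i`. -/
noncomputable def cubeIntensity (a δ : ℝ) (s : Finset ℤ) (θ : s → Bool) : C(I, ℝ) :=
  ⟨fun t => a + δ * ∑ i : s, signOf (θ i) * trigBasis i t, by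
    have := continuous_trigBasis
    fun_prop⟩

theorem cubeIntensity_apply (a δ : ℝ) (s : Finset ℤ) (θ : s → Bool) (t : I) :
    cubeIntensity a δ s θ t = a + δ * ∑ i : s, signOf (θ i) * trigBasis i t := rfl

theorem fourierCoef_cubeIntensity (a δ : ℝ) (s : Finset ℤ) (θ : s → Bool) (j : ℤ) :
    fourierCoef (contL2 (cubeIntensity a δ s θ)) j =
      (if j = 0 then a else 0) + if h : j ∈ s then δ * signOf (θ ⟨j, h⟩) else 0 := by
  have hc := continuous_trigBasis
  have h : ∀ t, cubeIntensity a δ s θ t * trigBasis j t = a * (trigBasis 0 t * trigBasis j t) +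
      δ * ∑ i : s, signOf (θ i) * (trigBasis i t * trigBasis j t) := fun t => by
    rw [cubeIntensity_apply, show trigBasis 0 t = 1 from if_pos rfl, add_mul, mul_assoc δ,
      Finset.sum_mul]
    simp only [one_mul, mul_assoc]
  rw [fourierCoef_contL2]
  simp_rw [h]
  rw [integral_add (integrable_of_continuous (by fun_prop))
    (integrable_of_continuous (by fun_prop)), integral_const_mul, integral_const_mul,
    integral_finsetSum _ fun i _ => integrable_of_continuous (by fun_prop)]
  simp_rw [integral_const_mul, integral_trigBasis_mul]
  congr 1
  · simp [eq_comm]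
  · split_ifs with hj
    · rw [Finset.sum_eq_single ⟨j, hj⟩]
      · simp
      · intro i _ hij
        rw [if_neg fun h => hij (Subtype.ext h), mul_zero]
      · simp
    · rw [Finset.sum_eq_zero, mul_zero]
      intro i _
      rw [if_neg fun h : (i : ℤ) = j => hj (h ▸ i.2), mul_zero]

section Cube

variable {a δ : ℝ} {s : Finset ℤ}

theorem half_le_cubeIntensity (hδ : 0 ≤ δ) (h : √2 * δ * s.card ≤ a / 2) (θ : s → Bool) (t : I) :
    a / 2 ≤ cubeIntensity a δ s θ t := by
  have h1 : |∑ i : s, signOf (θ i) * trigBasis i t| ≤ s.card * √2 := by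
    refine (Finset.abs_sum_le_sum_abs _ _).trans ?_
    refine (Finset.sum_le_card_nsmul _ _ √2 fun i _ => ?_).trans_eq ?_
    · rw [abs_mul, abs_signOf, one_mul]; exact abs_trigBasis_le _ _
    · simp
  have h2 := mul_le_mul_of_nonneg_left (neg_le_of_abs_le h1) hδ
  rw [cubeIntensity_apply]
  nlinarith

theorem cubeIntensity_update_sub_sq_le (θ : s → Bool) (i : s) (t : I) :
    (cubeIntensity a δ s (Function.update θ i (!θ i)) t - cubeIntensity a δ s θ t) ^ 2
      ≤ 8 * δ ^ 2 := by
  have h : cubeIntensity a δ s (Function.update θ i (!θ i)) t - cubeIntensity a δ s θ t =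
      δ * ((signOf (!θ i) - signOf (θ i)) * trigBasis i t) := by
    rw [cubeIntensity_apply, cubeIntensity_apply, add_sub_add_left_eq_sub, ← mul_sub,
      ← Finset.sum_sub_distrib, Finset.sum_eq_single i]
    · rw [Function.update_self]; ring
    · intro j _ hj
      rw [Function.update_of_ne hj, sub_self]
    · simp
  have h2 : trigBasis i t ^ 2 ≤ 2 := by
    rw [← sq_abs, ← Real.sq_sqrt zero_le_two]
    gcongr
    exact abs_trigBasis_le _ _
  rw [h, mul_pow, mul_pow, ← neg_sub, neg_sq, signOf_sub_not_sq]
  nlinarith [sq_nonneg δ]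

theorem cubeIntensity_mem_intensityClass {γ : ℤ → ℝ} {L : ℝ} (hγ : IsWeightSeq γ) (ha : 0 ≤ a)
    (hδ : 0 ≤ δ) (h : √2 * δ * s.card ≤ a / 2)
    (hL : 2 * a ^ 2 + 2 * (δ ^ 2 * ∑ j ∈ s, γ j ^ 2) ≤ L ^ 2) (θ : s → Bool) :
    contL2 (cubeIntensity a δ s θ) ∈ intensityClass γ L := by
  have hm : HasSum (fun j : ℤ => (if j = 0 then 2 * a ^ 2 else 0) +
      if j ∈ s then 2 * (δ ^ 2 * γ j ^ 2) else 0)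
      (2 * a ^ 2 + 2 * (δ ^ 2 * ∑ j ∈ s, γ j ^ 2)) := by
    refine (hasSum_ite_eq 0 _).add ?_
    rw [Finset.mul_sum, Finset.mul_sum]
    have := hasSum_sum_of_ne_finset_zero (L := SummationFilter.unconditional ℤ)
      (f := fun j : ℤ => if j ∈ s then 2 * (δ ^ 2 * γ j ^ 2) else 0) (s := s)
      fun j hj => if_neg hj
    rwa [Finset.sum_congr rfl fun j hj => if_pos hj] at this
  have hle : ∀ j, γ j ^ 2 * fourierCoef (contL2 (cubeIntensity a δ s θ)) j ^ 2 ≤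
      (if j = 0 then 2 * a ^ 2 else 0) + if j ∈ s then 2 * (δ ^ 2 * γ j ^ 2) else 0 := fun j => by
    rw [fourierCoef_cubeIntensity]
    by_cases h0 : j = 0 <;> by_cases hj : j ∈ s
    · subst h0
      rw [dif_pos hj, if_pos rfl, if_pos rfl, if_pos hj, hγ.zero]
      -- Only at frequency zero can the level `a` and a perturbation meet, whence `(x + y)² ≤ 2x² +
      -- 2y²`.
      nlinarith [sq_nonneg (a - δ * signOf (θ ⟨0, hj⟩)), signOf_sq (θ ⟨0, hj⟩)]
    · subst h0
      rw [dif_neg hj, if_pos rfl, if_pos rfl, if_neg hj, hγ.zero]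
      nlinarith [sq_nonneg a]
    · simp only [dif_pos hj, if_neg h0, if_pos hj]
      rw [zero_add, zero_add, mul_pow, signOf_sq, mul_one, mul_comm]
      have : 0 ≤ δ ^ 2 * γ j ^ 2 := by positivity
      linarith
    · simp [hj, h0]
  have hsum := Summable.of_nonneg_of_le (fun j => by positivity) hle hm.summable
  refine ⟨?_, hsum, (hasSum_le hle hsum.hasSum hm).trans hL⟩
  filter_upwards [coeFn_contL2 (cubeIntensity a δ s θ)] with t ht
  rw [ht]
  exact (by positivity : 0 ≤ a / 2).trans (half_le_cubeIntensity hδ h θ t)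

/-- Assouad's lower bound over the hypercube of intensities. -/
theorem card_mul_sq_le_minimaxRisk {γ : ℤ → ℝ} {L : ℝ} {n : ℕ} (hγ : IsWeightSeq γ) (ha : 0 < a)
    (hδ : 0 ≤ δ) (h : √2 * δ * s.card ≤ a / 2)
    (hL : 2 * a ^ 2 + 2 * (δ ^ 2 * ∑ j ∈ s, γ j ^ 2) ≤ L ^ 2)
    (hn : n * (8 * δ ^ 2 / (a / 2)) ≤ 1) :
    ENNReal.ofReal (s.card * δ ^ 2 / 3) ≤ minimaxRisk γ L n := by
  refine le_iInf₂ fun T hT => ?_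
  set S := ⨆ lam ∈ intensityClass γ L, mise n T lam
  let lam : (s → Bool) → L2 := fun θ => contL2 (cubeIntensity a δ s θ)
  let A : s → (s → Bool) → ℝ≥0∞ := fun i θ =>
    ∫⁻ N, ENNReal.ofReal ((fourierCoef (T N) i - fourierCoef (lam θ) i) ^ 2) ∂(sampleLaw n (lam θ))
  have hTm : ∀ j, Measurable fun N => fourierCoef (T N) j := fun j =>
    ((continuous_fourierCoef j).comp_stronglyMeasurable hT).measurable
  have hS : ∀ θ, ∑ i, A i θ ≤ S := fun θ => by
    have h1 : mise n T (lam θ) ≤ S := le_iSup₂_of_le (lam θ)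
      (cubeIntensity_mem_intensityClass hγ ha.le hδ h hL θ) le_rfl
    refine le_trans ?_ h1
    rw [← lintegral_finsetSum _ fun i _ => by have := hTm i; fun_prop]
    refine lintegral_mono fun N => ?_
    simp only
    rw [← ENNReal.ofReal_sum_of_nonneg fun i _ => sq_nonneg _]
    refine ENNReal.ofReal_le_ofReal ?_
    rw [Finset.sum_coe_sort s fun i => (fourierCoef (T N) i - fourierCoef (lam θ) i) ^ 2]
    exact sum_fourierCoef_sub_sq_le _ _ _
  have hA : ∀ i θ, ENNReal.ofReal (2 * δ ^ 2 / 3) ≤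
      A i θ + A i (Function.update θ i (!θ i)) := fun i θ => by
    -- The constant is at most `e < 3`, by `hn`.
    have hD : ChiSqDominated (sampleLaw n (lam (Function.update θ i (!θ i))))
        (sampleLaw n (lam θ)) 3 := by
      refine (chiSqDominated_sampleLaw n (half_pos ha) (half_le_cubeIntensity hδ h θ)
        (fun t => (half_pos ha).le.trans (half_le_cubeIntensity hδ h _ t))
        (cubeIntensity_update_sub_sq_le θ i)).mono ?_
      rw [← ENNReal.ofReal_ofNat 3]
      refine ENNReal.ofReal_le_ofReal ((Real.exp_le_exp.2 hn).trans ?_)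
      linarith [Real.exp_one_lt_d9]
    have h2 := ofReal_sq_sub_le_of_chiSqDominated (by norm_num) hD (hTm i)
      (fourierCoef (lam θ) i) (fourierCoef (lam (Function.update θ i (!θ i))) i)
    -- The squared separation is `4δ²`; the factor `6 = 2 * 3` matches the two-point bound with `K =
    -- 3`.
    have h3 : (fourierCoef (lam θ) i - fourierCoef (lam (Function.update θ i (!θ i))) i) ^ 2
        = 6 * (2 * δ ^ 2 / 3) := by
      simp only [lam]
      rw [fourierCoef_cubeIntensity, fourierCoef_cubeIntensity, dif_pos i.2, dif_pos i.2,
        add_sub_add_left_eq_sub, ← mul_sub, mul_pow, Function.update_self, signOf_sub_not_sq]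
      ring
    rw [h3, ENNReal.ofReal_mul (by norm_num), ENNReal.ofReal_ofNat,
      show (2 * 3 : ℝ≥0∞) = 6 by norm_num] at h2
    exact (ENNReal.mul_le_mul_iff_right (by norm_num) (by norm_num)).1 h2
  have hfin := card_mul_le_two_mul_sum_of_flip A _ hA
  have hsum : ∑ θ, ∑ i, A i θ ≤ Fintype.card (s → Bool) * S := by
    refine (Finset.sum_le_sum fun θ _ => hS θ).trans_eq ?_
    rw [Finset.sum_const, nsmul_eq_mul, Finset.card_univ]
  have h4 : (Fintype.card (s → Bool) : ℝ≥0∞) * (2 * ENNReal.ofReal (s.card * δ ^ 2 / 3)) ≤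
      Fintype.card (s → Bool) * (2 * S) := by
    calc _ = (Fintype.card (s → Bool) : ℝ≥0∞) *
          (Fintype.card s * ENNReal.ofReal (2 * δ ^ 2 / 3)) := by
          rw [Fintype.card_coe, ← ENNReal.ofReal_natCast s.card, ← ENNReal.ofReal_ofNat 2,
            ← ENNReal.ofReal_mul (by norm_num), ← ENNReal.ofReal_mul (by positivity)]
          congr 2; ring
      _ ≤ _ := hfin
      _ ≤ 2 * (Fintype.card (s → Bool) * S) := by gcongr
      _ = _ := by ring
  have hc : (Fintype.card (s → Bool) : ℝ≥0∞) ≠ 0 := by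
    exact_mod_cast Fintype.card_ne_zero
  have h5 := (ENNReal.mul_le_mul_iff_right hc (ENNReal.natCast_ne_top _)).1 h4
  exact (ENNReal.mul_le_mul_iff_right (by norm_num) (by norm_num)).1 h5

end Cube

/-! ### Weight bounds and choice of parameters -/

theorem IsWeightSeq.sq_le_of_mem_Icc {γ : ℤ → ℝ} (hγ : IsWeightSeq γ) {k : ℕ} {j : ℤ}
    (hj : j ∈ Finset.Icc (-(k : ℤ)) k) : γ j ^ 2 ≤ γ k ^ 2 := by
  rw [Finset.mem_Icc] at hj
  have h1 : γ j = γ (j.natAbs : ℤ) := by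
    rcases Int.natAbs_eq j with h | h
    · rw [← h]
    · conv_lhs => rw [h, hγ.symm]
  rw [h1]
  have := hγ.mono (show j.natAbs ≤ k by omega)
  have h0 := (hγ.pos (j.natAbs : ℤ)).le
  gcongr

/-- Cauchy–Schwarz for `1 = γ_j * γ_j⁻¹`. It turns the ellipsoid budget into the sup-norm control
that keeps intensities positive. -/
theorem sq_card_le_mul_of_hasSum {γ : ℤ → ℝ} (hγ : ∀ j, 0 < γ j) {Γ : ℝ}
    (hΓ : HasSum (fun j : ℤ => (γ j ^ 2)⁻¹) Γ) (s : Finset ℤ) :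
    (s.card : ℝ) ^ 2 ≤ (∑ j ∈ s, γ j ^ 2) * Γ := by
  have h := Finset.sum_mul_sq_le_sq_mul_sq s γ fun j => (γ j)⁻¹
  simp only [mul_inv_cancel₀ (hγ _).ne', Finset.sum_const, nsmul_eq_mul, mul_one, inv_pow] at h
  refine h.trans ?_
  gcongr
  exact sum_le_hasSum s (fun j _ => by positivity) hΓ

end PoissonIntensity

theorem theorem3 (η L Γ : ℝ) (hη : 1 ≤ η) (hL : 0 < L) :
    ∃ c : ℝ, 0 < c ∧
      ∀ γ : ℤ → ℝ, PoissonIntensity.IsWeightSeq γ →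
        HasSum (fun j : ℤ => (γ j ^ 2)⁻¹) Γ →
        ∀ kstar : ℕ → ℕ,
          (∀ n : ℕ, 1 ≤ n → ∀ k : ℕ,
            PoissonIntensity.maxTerm γ n (kstar n) ≤ PoissonIntensity.maxTerm γ n k) →
          IsGLB {x : ℝ | ∃ n : ℕ, 1 ≤ n ∧
            x = (PoissonIntensity.maxTerm γ n (kstar n))⁻¹ *
              PoissonIntensity.minTerm γ n (kstar n)} η⁻¹ →
          ∀ n : ℕ, 1 ≤ n →
            ENNReal.ofReal (c * PoissonIntensity.maxTerm γ n (kstar n)) ≤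
              PoissonIntensity.minimaxRisk γ L n := by
  have hη0 : 0 < η := one_pos.trans_le hη
  let Γ₁ := max Γ 1
  have hΓ₁ : 0 < Γ₁ := one_pos.trans_le (le_max_right _ _)
  -- In order: ellipsoid membership, positivity of the intensities, and the chi-square bound, all at
  -- level `a = L / 2`.
  let ζ := min (L ^ 2 / (4 * η)) (min (L ^ 2 / (32 * η * Γ₁)) (L / 32))
  have hζ : 0 < ζ := by positivity
  have hζ1 : ζ * η ≤ L ^ 2 / 4 := by
    have : ζ ≤ L ^ 2 / (4 * η) := min_le_left _ _
    rw [le_div_iff₀ (by positivity)] at this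
    linarith
  have hζ2 : ζ * η * Γ₁ ≤ L ^ 2 / 32 := by
    have : ζ ≤ L ^ 2 / (32 * η * Γ₁) := (min_le_right _ _).trans (min_le_left _ _)
    rw [le_div_iff₀ (by positivity)] at this
    linarith
  have hζ3 : ζ ≤ L / 32 := (min_le_right _ _).trans (min_le_right _ _)
  -- The Assouad bound is `ζ (2k+1) / (3n)`, and (C2) gives `(2k+1) / n ≥ Ψ_n / η`.
  refine ⟨ζ / (3 * η), by positivity, ?_⟩
  intro γ hγ hΓ kstar _ hglb n hn
  have hn0 : (0 : ℝ) < n := by exact_mod_cast hn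
  set k := kstar n
  have hγk : 0 < γ k ^ 2 := pow_pos (hγ.pos _) 2
  set M := PoissonIntensity.maxTerm γ n k
  have hM : 0 < M := lt_max_of_lt_left (inv_pos.2 hγk)
  have hmin : M ≤ η * PoissonIntensity.minTerm γ n k := by
    have := hglb.1 ⟨n, hn, rfl⟩
    rw [inv_mul_eq_div, le_div_iff₀ hM, inv_mul_le_iff₀ hη0] at this
    exact this
  have hM1 : M ≤ η * (γ k ^ 2)⁻¹ := hmin.trans (by gcongr; exact min_le_left _ _)
  have hM2 : M ≤ η * ((2 * k + 1) / n) := hmin.trans (by gcongr; exact min_le_right _ _)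
  have hM3 : (2 * k + 1) / n ≤ M := le_max_right _ _
  have hk : (2 * k + 1) / n * γ k ^ 2 ≤ η := by
    rw [← le_div_iff₀ hγk, div_eq_mul_inv η]
    exact hM3.trans hM1
  let s := Finset.Icc (-(k : ℤ)) k
  have hcard : (s.card : ℝ) = 2 * k + 1 := by
    have : s.card = 2 * k + 1 := by simp only [s, Int.card_Icc]; omega
    rw [this]; push_cast; ring
  let δ := √(ζ / n)
  have hδ : δ ^ 2 = ζ / n := Real.sq_sqrt (by positivity)
  have hA : δ ^ 2 * ∑ j ∈ s, γ j ^ 2 ≤ ζ * η := by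
    have : ∑ j ∈ s, γ j ^ 2 ≤ (2 * k + 1) * γ k ^ 2 := by
      rw [← hcard, ← nsmul_eq_mul]
      exact Finset.sum_le_card_nsmul _ _ _ fun j hj => hγ.sq_le_of_mem_Icc hj
    calc δ ^ 2 * ∑ j ∈ s, γ j ^ 2 ≤ ζ / n * ((2 * k + 1) * γ k ^ 2) := by rw [hδ]; gcongr
      _ = ζ * ((2 * k + 1) / n * γ k ^ 2) := by ring
      _ ≤ _ := by gcongr
  have hA0 : 0 ≤ ∑ j ∈ s, γ j ^ 2 := Finset.sum_nonneg fun j _ => sq_nonneg _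
  have hcs : √2 * δ * s.card ≤ L / 2 / 2 := by
    refine le_of_sq_le_sq ?_ (by positivity)
    calc (√2 * δ * s.card) ^ 2 = 2 * δ ^ 2 * (s.card : ℝ) ^ 2 := by
          rw [mul_pow, mul_pow, Real.sq_sqrt zero_le_two]
      _ ≤ 2 * δ ^ 2 * ((∑ j ∈ s, γ j ^ 2) * Γ₁) := by
          gcongr
          refine (PoissonIntensity.sq_card_le_mul_of_hasSum hγ.pos hΓ s).trans ?_
          gcongr
          exact le_max_left _ _
      _ = 2 * (δ ^ 2 * ∑ j ∈ s, γ j ^ 2) * Γ₁ := by ring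
      _ ≤ 2 * (ζ * η) * Γ₁ := by gcongr
      _ ≤ (L / 2 / 2) ^ 2 := by linarith
  refine le_trans (ENNReal.ofReal_le_ofReal ?_) (PoissonIntensity.card_mul_sq_le_minimaxRisk
    (a := L / 2) (δ := δ) (s := s) hγ (by positivity) (Real.sqrt_nonneg _) hcs ?_ ?_)
  · rw [hcard, hδ]
    calc ζ / (3 * η) * M ≤ ζ / (3 * η) * (η * ((2 * k + 1) / n)) := by gcongr
      _ = _ := by field_simp
  · linarith
  · rw [hδ]
    have : (n : ℝ) * (8 * (ζ / n) / (L / 2 / 2)) = 32 * ζ / L := by field_simp; ring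
    rw [this, div_le_one hL]
    linarith
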